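/- For $p\in[1,2)$ and a matrix $M\in\mathbb{R}^{k\times d}$ with rows $a_1,\dots,a_k\in\mathbb{R}^d$ (viewed as column vectors), the $\ell_p$ Lewis weights $w_1(M),\dots,w_k(M)$ of $M$ are the real numbers, with $w_i(M)>0$ whenever $a_i\ne 0$ and $w_i(M)=0$ whenever $a_i=0$, such that $$w_i(M)=\bigl(a_i^\top(M^\top W^{1-2/p}M)^{\dagger}a_i\bigr)^{p/2}\quad\text{for all } i,\qquad W=\mathrm{diag}(w_1(M),\dots,w_k(M)),$$ where ${}^\dagger$ is the Moore–Penrose inverse and zero rows are left out of the product $M^\top W^{1-2/p}M$. For $A\in\mathbb{R}^{n\times d}$, let $A^{(i)}$ consist of the first $i$ rows of $A$. The online $\ell_p$ Lewis weights of $A$ are $w_i^{\mathrm{OL}}(A)=w_i(A^{(i)})$, $i=1,\dots,n$, and the online condition number of $A$ is $\kappa^{\mathrm{OL}}(A)=\|A\|_2\max_{\emptyset\ne S\subseteq[n]}\|A_S^\dagger\|_2$, where $A_S$ is the submatrix of the rows of $A$ with index in $S$ and $\|\cdot\|_2$ is the operator norm. There is an absolute constant $C>0$ such that for all $p\in[1,2)$,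 all $n,d$ and all $A\in\mathbb{R}^{n\times d}$, the Lewis weights of every $A^{(i)}$ exist and are unique, and $$\sum_{i=1}^n w_i^{\mathrm{OL}}(A)\le C\,d\,\max\{1,\log n\}\,\max\{1,\log\kappa^{\mathrm{OL}}(A)\}$$ (where $\log$ is the natural logarithm, with the convention $\log 0=0$ for the trivial cases $n=0$ and $A=0$). In particular, $\sum_{i=1}^n w_i^{\mathrm{OL}}(A)=O(d\log n\cdot\log\kappa^{\mathrm{OL}}(A))$ as soon as $n$ and $\kappa^{\mathrm{OL}}(A)$ are bounded away from $1$, say $n\ge 2$ and $\kappa^{\mathrm{OL}}(A)\ge 2$. -/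

import Mathlib

open scoped Matrix

/-- The four Penrose equations: `X` is the Moore–Penrose inverse of the real matrix `A`. -/
structure IsMoorePenroseInverse {m n : Type*} [Fintype m] [Fintype n]
    (A : Matrix m n ℝ) (X : Matrix n m ℝ) : Prop where
  mul_mul_left : A * X * A = A
  mul_mul_right : X * A * X = X
  symm_left : (A * X)ᵀ = A * X
  symm_right : (X * A)ᵀ = X * A

/-- Every real matrix has a Moore–Penrose inverse. -/
theorem exists_isMoorePenroseInverse {m n : Type*} [Fintype m] [Fintype n]
    (A : Matrix m n ℝ) : ∃ X, IsMoorePenroseInverse A X := by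
  classical
  have hH : (Aᵀ * A).IsHermitian := by
    simpa [Matrix.conjTranspose_eq_transpose_of_trivial] using
      Matrix.isHermitian_conjTranspose_mul_self A
  obtain ⟨G, hG1, hG2, hG3, hG4⟩ : ∃ G : Matrix n n ℝ,
      (Aᵀ * A) * G * (Aᵀ * A) = Aᵀ * A ∧ G * (Aᵀ * A) * G = G ∧ Gᵀ = G ∧
      (G * (Aᵀ * A))ᵀ = G * (Aᵀ * A) := by
    have hs := hH.spectral_theorem
    set U : Matrix n n ℝ := (hH.eigenvectorUnitary : Matrix n n ℝ) with hU
    have hUU : Uᵀ * U = 1 := by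
      have := Unitary.coe_star_mul_self hH.eigenvectorUnitary
      simpa [Matrix.star_eq_conjTranspose, Matrix.conjTranspose_eq_transpose_of_trivial] using this
    have hs' : Aᵀ * A = U * Matrix.diagonal hH.eigenvalues * Uᵀ := by
      rw [Unitary.conjStarAlgAut_apply] at hs
      simpa [Matrix.star_eq_conjTranspose, Matrix.conjTranspose_eq_transpose_of_trivial,
        Function.comp_def] using hs
    generalize hH.eigenvalues = e at hs'
    have key : ∀ a b : n → ℝ, (U * Matrix.diagonal a * Uᵀ) * (U * Matrix.diagonal b * Uᵀ) =
        U * Matrix.diagonal (fun i => a i * b i) * Uᵀ := by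
      intro a b
      calc _ = U * Matrix.diagonal a * (Uᵀ * U) * Matrix.diagonal b * Uᵀ := by
            simp only [Matrix.mul_assoc]
        _ = _ := by
            rw [hUU, Matrix.mul_one, Matrix.mul_assoc U, Matrix.diagonal_mul_diagonal]
    have keyT : ∀ a : n → ℝ, (U * Matrix.diagonal a * Uᵀ)ᵀ = U * Matrix.diagonal a * Uᵀ := by
      intro a
      simp [Matrix.transpose_mul, Matrix.mul_assoc]
    refine ⟨U * Matrix.diagonal (fun i => (e i)⁻¹) * Uᵀ, ?_, ?_, keyT _, ?_⟩
    · rw [hs', key, key]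
      congr 3; ext i
      by_cases h : e i = 0 <;> simp [h]
    · rw [hs', key, key]
      congr 3; ext i
      by_cases h : e i = 0 <;> simp [h]
    · rw [hs', key, keyT]
  have hA : A * (G * (Aᵀ * A) - 1) = 0 := by
    have h0 : (A * (G * (Aᵀ * A) - 1))ᵀ * (A * (G * (Aᵀ * A) - 1)) = 0 := by
      have h1 : (Aᵀ * A) * (G * (Aᵀ * A) - 1) = 0 := by
        rw [Matrix.mul_sub, ← Matrix.mul_assoc, hG1, Matrix.mul_one, sub_self]
      rw [Matrix.transpose_mul, Matrix.mul_assoc, ← Matrix.mul_assoc Aᵀ A, h1, Matrix.mul_zero]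
    rw [← Matrix.conjTranspose_eq_transpose_of_trivial] at h0
    exact Matrix.conjTranspose_mul_self_eq_zero.mp h0
  have hA' : A * (G * (Aᵀ * A)) = A := by
    rw [Matrix.mul_sub, Matrix.mul_one, sub_eq_zero] at hA
    exact hA
  refine ⟨G * Aᵀ, ?_, ?_, ?_, ?_⟩
  · calc A * (G * Aᵀ) * A = A * (G * (Aᵀ * A)) := by simp only [Matrix.mul_assoc]
      _ = A := hA'
  · calc G * Aᵀ * A * (G * Aᵀ) = (G * (Aᵀ * A) * G) * Aᵀ := by simp only [Matrix.mul_assoc]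
      _ = _ := by rw [hG2]
  · simp [Matrix.transpose_mul, hG3, Matrix.mul_assoc]
  · rw [Matrix.mul_assoc, hG4]

/-- The Moore–Penrose inverse is unique. -/
theorem IsMoorePenroseInverse.unique {m n : Type*} [Fintype m] [Fintype n]
    {A : Matrix m n ℝ} {X Y : Matrix n m ℝ}
    (hX : IsMoorePenroseInverse A X) (hY : IsMoorePenroseInverse A Y) : X = Y := by
  have h1 : A * X = A * Y := by
    calc A * X = (A * X)ᵀ := hX.symm_left.symm
      _ = (A * Y * A * X)ᵀ := by rw [hY.mul_mul_left]
      _ = ((A * Y) * (A * X))ᵀ := by simp only [Matrix.mul_assoc]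
      _ = (A * X) * (A * Y) := by rw [Matrix.transpose_mul, hX.symm_left, hY.symm_left]
      _ = A * X * A * Y := by simp only [Matrix.mul_assoc]
      _ = A * Y := by rw [hX.mul_mul_left]
  have h2 : X * A = Y * A := by
    calc X * A = (X * A)ᵀ := hX.symm_right.symm
      _ = (X * (A * Y * A))ᵀ := by rw [hY.mul_mul_left]
      _ = ((X * A) * (Y * A))ᵀ := by simp only [Matrix.mul_assoc]
      _ = (Y * A) * (X * A) := by rw [Matrix.transpose_mul, hX.symm_right, hY.symm_right]
      _ = Y * (A * X * A) := by simp only [Matrix.mul_assoc]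
      _ = Y * A := by rw [hX.mul_mul_left]
  calc X = X * A * X := hX.mul_mul_right.symm
    _ = Y * (A * X) := by rw [h2, Matrix.mul_assoc]
    _ = Y * A * Y := by rw [h1, Matrix.mul_assoc]
    _ = Y := hY.mul_mul_right

/-- The Moore–Penrose inverse `A†` of a real matrix. -/
noncomputable def pinv {m n : Type*} [Fintype m] [Fintype n] (A : Matrix m n ℝ) :
    Matrix n m ℝ :=
  Classical.choose (exists_isMoorePenroseInverse A)

theorem pinv_spec {m n : Type*} [Fintype m] [Fintype n] (A : Matrix m n ℝ) :
    IsMoorePenroseInverse A (pinv A) :=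
  Classical.choose_spec (exists_isMoorePenroseInverse A)

/-- `w` is a family of `ℓ_p` Lewis weights of `A`, whose rows are `A i`:
`w i = (aᵢᵀ (Aᵀ W^(1 - 2/p) A)† aᵢ)^(p/2)` with `W = diag w`. For `p < 2` the exponent `1 - 2/p` is
negative, so the equation only makes sense where the weights do not vanish. The weight of a
nonzero row is therefore required to be positive; a zero row gets weight `0` from the equation and
contributes nothing to the matrix `Aᵀ W^(1 - 2/p) A`. -/
structure IsLewisWeights (p : ℝ) {n d : ℕ} (A : Matrix (Fin n) (Fin d) ℝ) (w : Fin n → ℝ) :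
    Prop where
  pos : ∀ i, A i ≠ 0 → 0 < w i
  eq : ∀ i, w i =
    (A i ⬝ᵥ (pinv (Aᵀ * Matrix.diagonal (fun j => w j ^ (1 - 2 / p)) * A) *ᵥ A i)) ^ (p / 2)

open Classical in
/-- The `ℓ_p` Lewis weights of `A` (a default value is used if there are none). -/
noncomputable def lewisWeights (p : ℝ) {n d : ℕ} (A : Matrix (Fin n) (Fin d) ℝ) : Fin n → ℝ :=
  if h : ∃ w, IsLewisWeights p A w then Classical.choose h else 0

/-- The submatrix of the rows of `A` up to and including row `i`; with rows numbered from `0`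
these are the first `i + 1` rows. -/
def rowsUpTo {n d : ℕ} (A : Matrix (Fin n) (Fin d) ℝ) (i : Fin n) :
    Matrix (Fin (i.val + 1)) (Fin d) ℝ :=
  A.submatrix (Fin.castLE i.isLt) id

/-- The online `ℓ_p` Lewis weight of row `i`: its Lewis weight among the rows seen so far, of
which it is the last one. -/
noncomputable def onlineLewisWeight (p : ℝ) {n d : ℕ} (A : Matrix (Fin n) (Fin d) ℝ)
    (i : Fin n) : ℝ :=
  lewisWeights p (rowsUpTo A i) (Fin.last i.val)

open scoped Matrix.Norms.L2Operator in
/-- The online condition number `‖A‖₂ · max_{∅ ≠ S ⊆ [n]} ‖(A_S)†‖₂`, where `A_S` consists of the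
rows of `A` with index in `S` and the norms are the operator norms for the Euclidean norms. -/
noncomputable def onlineCond {n d : ℕ} (A : Matrix (Fin n) (Fin d) ℝ) : ℝ :=
  ‖A‖ * ⨆ S : {S : Finset (Fin n) // S.Nonempty},
    ‖pinv (A.submatrix (fun i : {i // i ∈ S.val} => i.val) id)‖

/-! The bound is a potential argument for Φ(t) = log det(λI + AᵀD_tA), where the diagonal matrix D_t
holds the powers w^(1 - 2/p) of the Lewis weights of the first t rows. New rows can only lower the
old weights (`IsLewisWeights.le_of_extends`), and 1 - 2/p < 0, so D_t increases with t. The next row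
therefore adds at least its own rank-one term. Its coefficient times its leverage is w^(1 -
2/p)·w^(2/p) = w, so by the matrix determinant lemma the determinant grows by a factor of at least 1
+ w/2 (`det_ridgeGram_onlineCoeff_succ`); the half pays for λ, the inverse square of the largest
‖A_S†‖.

Since w ≤ 1, Φ rises by at least w/3 at each row. In total it rises by at most d log(1 + n²κ²),
because AᵀD_nA ≤ n²AᵀA (`IsLewisWeights.weightedForm_le`).

Existence of the weights is Banach's fixed point theorem for their logarithms; uniqueness is
monotonicity applied in both directions. -/

/-- The quadratic form `x ↦ ∑ⱼ sⱼ (aⱼ · x)²` of the weighted Gram matrix `Aᵀ diag(s) A`. -/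
def weightedForm {n d : ℕ} (A : Matrix (Fin n) (Fin d) ℝ) (s : Fin n → ℝ) (x : Fin d → ℝ) : ℝ :=
  ∑ j, s j * (A j ⬝ᵥ x) ^ 2

/-- The quantity `aᵢᵀ (Aᵀ diag(s) A)† aᵢ`. -/
noncomputable def leverage {n d : ℕ} (A : Matrix (Fin n) (Fin d) ℝ) (s : Fin n → ℝ)
    (i : Fin n) : ℝ :=
  A i ⬝ᵥ (pinv (Aᵀ * Matrix.diagonal s * A) *ᵥ A i)

/-! ### Variational description of leverages. -/

section Leverage

variable {n m d : ℕ} {A : Matrix (Fin n) (Fin d) ℝ} {s : Fin n → ℝ}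

theorem dotProduct_gram_mulVec (A : Matrix (Fin n) (Fin d) ℝ) (s : Fin n → ℝ) (x y : Fin d → ℝ) :
    x ⬝ᵥ ((Aᵀ * Matrix.diagonal s * A) *ᵥ y) = ∑ j, s j * ((A j ⬝ᵥ x) * (A j ⬝ᵥ y)) := by
  rw [← Matrix.mulVec_mulVec, ← Matrix.mulVec_mulVec, Matrix.dotProduct_mulVec,
    Matrix.vecMul_transpose]
  simp only [dotProduct, Matrix.mulVec_diagonal]
  refine Finset.sum_congr rfl fun j _ => ?_
  simp only [Matrix.mulVec, dotProduct]
  ring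

theorem dotProduct_gram_mulVec_self (A : Matrix (Fin n) (Fin d) ℝ) (s : Fin n → ℝ)
    (x : Fin d → ℝ) :
    x ⬝ᵥ ((Aᵀ * Matrix.diagonal s * A) *ᵥ x) = weightedForm A s x := by
  rw [dotProduct_gram_mulVec]
  simp only [weightedForm, sq]

theorem gram_transpose (A : Matrix (Fin n) (Fin d) ℝ) (s : Fin n → ℝ) :
    (Aᵀ * Matrix.diagonal s * A)ᵀ = Aᵀ * Matrix.diagonal s * A := by
  simp [Matrix.transpose_mul, Matrix.mul_assoc]

theorem weightedForm_nonneg (hs : ∀ j, 0 ≤ s j) (x : Fin d → ℝ) : 0 ≤ weightedForm A s x :=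
  Finset.sum_nonneg fun j _ => mul_nonneg (hs j) (sq_nonneg _)

theorem sq_dotProduct_gram_mulVec_le (hs : ∀ j, 0 ≤ s j) (x y : Fin d → ℝ) :
    (x ⬝ᵥ ((Aᵀ * Matrix.diagonal s * A) *ᵥ y)) ^ 2 ≤ weightedForm A s x * weightedForm A s y := by
  rw [dotProduct_gram_mulVec]
  refine Finset.sum_sq_le_sum_mul_sum_of_sq_le_mul _ (fun j _ => mul_nonneg (hs j) (sq_nonneg _))
    (fun j _ => mul_nonneg (hs j) (sq_nonneg _)) fun j _ => ?_
  exact le_of_eq (by ring)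

/-- A vector killed by the Gram matrix has zero form, hence is orthogonal to every row of nonzero
coefficient. Such a row thus lies in the range, which the pseudoinverse inverts. -/
theorem mulVec_pinv_mulVec_row (hs : ∀ j, 0 ≤ s j) {i : Fin n} (hi : A i = 0 ∨ s i ≠ 0) :
    (Aᵀ * Matrix.diagonal s * A) *ᵥ (pinv (Aᵀ * Matrix.diagonal s * A) *ᵥ A i) = A i := by
  have hT := gram_transpose A s
  have hform := dotProduct_gram_mulVec_self A s
  generalize Aᵀ * Matrix.diagonal s * A = M at hT hform
  have hX := pinv_spec M
  generalize pinv M = X at hX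
  set z := A i - M *ᵥ (X *ᵥ A i) with hz
  have hMM : M * M * X = M := by
    have h1 := congrArg Matrix.transpose hX.mul_mul_left
    rw [Matrix.transpose_mul, hX.symm_left, hT] at h1
    rw [Matrix.mul_assoc, h1]
  have hMz : M *ᵥ z = 0 := by
    rw [hz, Matrix.mulVec_sub, Matrix.mulVec_mulVec, Matrix.mulVec_mulVec, hMM, sub_self]
  have haz : A i ⬝ᵥ z = 0 := by
    rcases hi with hi | hi
    · rw [hi, zero_dotProduct]
    · have h0 : weightedForm A s z = 0 := by rw [← hform, hMz, dotProduct_zero]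
      have h1 := (Finset.sum_eq_zero_iff_of_nonneg
        (fun j _ => mul_nonneg (hs j) (sq_nonneg _))).mp h0 i (Finset.mem_univ i)
      simpa [hi] using h1
  have hzz : z ⬝ᵥ z = 0 := by
    have h2 : z ⬝ᵥ (M *ᵥ (X *ᵥ A i)) = 0 := by
      rw [Matrix.dotProduct_mulVec, ← Matrix.mulVec_transpose, hT, hMz, zero_dotProduct]
    calc z ⬝ᵥ z = z ⬝ᵥ A i - z ⬝ᵥ (M *ᵥ (X *ᵥ A i)) := by
          conv_lhs => rw [hz, dotProduct_sub]
      _ = 0 := by rw [h2, dotProduct_comm, haz, sub_zero]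
  exact (sub_eq_zero.mp (dotProduct_self_eq_zero.mp hzz)).symm

/-- The leverage is attained by a vector. -/
theorem exists_dotProduct_eq_leverage (hs : ∀ j, 0 ≤ s j) {i : Fin n} (hi : A i = 0 ∨ s i ≠ 0) :
    ∃ y, A i ⬝ᵥ y = leverage A s i ∧ weightedForm A s y = leverage A s i := by
  refine ⟨_, rfl, ?_⟩
  rw [← dotProduct_gram_mulVec_self, mulVec_pinv_mulVec_row hs hi, dotProduct_comm]
  rfl

theorem sq_dotProduct_le_leverage_mul (hs : ∀ j, 0 ≤ s j) {i : Fin n} (hi : A i = 0 ∨ s i ≠ 0)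
    (x : Fin d → ℝ) : (A i ⬝ᵥ x) ^ 2 ≤ leverage A s i * weightedForm A s x := by
  have h1 := mulVec_pinv_mulVec_row hs hi
  have h2 := sq_dotProduct_gram_mulVec_le (A := A) hs x
    (pinv (Aᵀ * Matrix.diagonal s * A) *ᵥ A i)
  rw [← dotProduct_gram_mulVec_self A s (_ *ᵥ _), h1, dotProduct_comm x,
    dotProduct_comm (_ *ᵥ _), mul_comm] at h2
  exact h2

theorem leverage_nonneg (hs : ∀ j, 0 ≤ s j) {i : Fin n} (hi : A i = 0 ∨ s i ≠ 0) :
    0 ≤ leverage A s i := by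
  obtain ⟨y, -, h⟩ := exists_dotProduct_eq_leverage hs hi
  exact h ▸ weightedForm_nonneg hs y

/-- With `sq_dotProduct_le_leverage_mul`, this makes the leverage the least constant in a
Cauchy–Schwarz inequality, so later comparisons need no pseudoinverse. -/
theorem leverage_le (hs : ∀ j, 0 ≤ s j) {i : Fin n} (hi : A i = 0 ∨ s i ≠ 0) {c : ℝ} (hc : 0 ≤ c)
    (h : ∀ x, (A i ⬝ᵥ x) ^ 2 ≤ c * weightedForm A s x) : leverage A s i ≤ c := by
  obtain ⟨y, h1, h2⟩ := exists_dotProduct_eq_leverage hs hi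
  have h3 := h y
  rw [h1, h2] at h3
  rcases (leverage_nonneg hs hi).eq_or_lt with h0 | h0
  · rwa [← h0]
  · nlinarith

theorem leverage_pos (hs : ∀ j, 0 ≤ s j) {i : Fin n} (hi : s i ≠ 0) (ha : A i ≠ 0) :
    0 < leverage A s i := by
  refine (leverage_nonneg hs (Or.inr hi)).lt_of_ne fun h0 => ha ?_
  have h := sq_dotProduct_le_leverage_mul (A := A) hs (Or.inr hi) (A i)
  rw [← h0, zero_mul] at h
  exact dotProduct_self_eq_zero.mp (pow_eq_zero_iff two_ne_zero |>.mp (le_antisymm h (sq_nonneg _)))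

theorem leverage_le_mul {A' : Matrix (Fin m) (Fin d) ℝ} {s' : Fin m → ℝ} (hs : ∀ j, 0 ≤ s j)
    (hs' : ∀ j, 0 ≤ s' j) {i : Fin n} {i' : Fin m} (hi : A i = 0 ∨ s i ≠ 0)
    (hi' : A' i' = 0 ∨ s' i' ≠ 0) (hA : A' i' = A i) {c : ℝ} (hc : 0 ≤ c)
    (h : ∀ x, weightedForm A s x ≤ c * weightedForm A' s' x) :
    leverage A' s' i' ≤ c * leverage A s i := by
  refine leverage_le hs' hi' (mul_nonneg hc (leverage_nonneg hs hi)) fun x => ?_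
  rw [hA]
  calc (A i ⬝ᵥ x) ^ 2 ≤ leverage A s i * weightedForm A s x := sq_dotProduct_le_leverage_mul hs hi x
    _ ≤ leverage A s i * (c * weightedForm A' s' x) :=
      mul_le_mul_of_nonneg_left (h x) (leverage_nonneg hs hi)
    _ = _ := by ring

end Leverage

/-! ### Monotonicity, uniqueness and existence of Lewis weights. -/

section LewisWeights

variable {p : ℝ} {n d : ℕ} {A A' : Matrix (Fin n) (Fin d) ℝ} {w w' : Fin n → ℝ}

theorem IsLewisWeights.eq_zero (hp : 0 < p) (hw : IsLewisWeights p A w) {i : Fin n}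
    (hi : A i = 0) : w i = 0 := by
  rw [hw.eq i, hi, zero_dotProduct, Real.zero_rpow (by positivity)]

theorem IsLewisWeights.nonneg (hp : 0 < p) (hw : IsLewisWeights p A w) (i : Fin n) : 0 ≤ w i := by
  by_cases hi : A i = 0
  · exact (hw.eq_zero hp hi).ge
  · exact (hw.pos i hi).le

theorem IsLewisWeights.rpow_nonneg (hp : 0 < p) (hw : IsLewisWeights p A w) (r : ℝ) (i : Fin n) :
    0 ≤ w i ^ r :=
  Real.rpow_nonneg (hw.nonneg hp i) r

theorem IsLewisWeights.row_eq_zero_or (hw : IsLewisWeights p A w) (r : ℝ) (i : Fin n) :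
    A i = 0 ∨ w i ^ r ≠ 0 := by
  by_cases hi : A i = 0
  · exact Or.inl hi
  · exact Or.inr (Real.rpow_pos_of_pos (hw.pos i hi) r).ne'

theorem IsLewisWeights.leverage_eq (hp : 0 < p) (hw : IsLewisWeights p A w) (i : Fin n) :
    leverage A (fun j => w j ^ (1 - 2 / p)) i = w i ^ (2 / p) := by
  have h : w i = leverage A (fun j => w j ^ (1 - 2 / p)) i ^ (p / 2) := hw.eq i
  have h0 := leverage_nonneg (hw.rpow_nonneg hp (1 - 2 / p)) (hw.row_eq_zero_or _ i)
  conv_rhs => rw [h, ← Real.rpow_mul h0, show p / 2 * (2 / p) = 1 by field_simp, Real.rpow_one]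

/-- Lewis weights decrease when further rows are added. -/
theorem IsLewisWeights.le_of_extends (hp : 0 < p) (hp2 : p < 2) (hw : IsLewisWeights p A w)
    (hw' : IsLewisWeights p A' w') (h : ∀ j, A j = 0 ∨ A' j = A j) {i : Fin n} (hi : A i ≠ 0) :
    w' i ≤ w i := by
  classical
  -- Maximum principle: it is enough to bound the largest ratio `c` of new to old weight.
  obtain ⟨k, hk, hmax⟩ := Finset.exists_max_image (Finset.univ.filter fun j => A j ≠ 0)
    (fun j => w' j / w j) ⟨i, by simpa using hi⟩
  simp only [Finset.mem_filter, Finset.mem_univ, true_and] at hk hmax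
  set c := w' k / w k with hc
  have hwk := hw.pos k hk
  have hwi := hw.pos i hi
  have hA'k : A' k = A k := (h k).resolve_left hk
  have hwk' : 0 < w' k := hw'.pos k (hA'k ▸ hk)
  have hc0 : 0 < c := div_pos hwk' hwk
  suffices hc1 : c ≤ 1 by
    have := (hmax i hi).trans hc1
    rwa [div_le_one hwi] at this
  have hneg : 1 - 2 / p ≤ 0 := by
    rw [sub_nonpos, le_div_iff₀ hp]; linarith
  have hform : ∀ x, weightedForm A (fun j => w j ^ (1 - 2 / p)) x ≤
      c ^ (2 / p - 1) * weightedForm A' (fun j => w' j ^ (1 - 2 / p)) x := by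
    intro x
    simp only [weightedForm, Finset.mul_sum]
    refine Finset.sum_le_sum fun j _ => ?_
    by_cases hj : A j = 0
    · rw [hj, zero_dotProduct, zero_pow two_ne_zero, mul_zero]
      exact mul_nonneg (Real.rpow_nonneg hc0.le _)
        (mul_nonneg (hw'.rpow_nonneg hp _ j) (sq_nonneg _))
    · have hj' := (h j).resolve_left hj
      have hwj := hw.pos j hj
      have hwj' : 0 < w' j := hw'.pos j (hj' ▸ hj)
      rw [hj', ← mul_assoc]
      refine mul_le_mul_of_nonneg_right ?_ (sq_nonneg _)
      have h1 : w' j ≤ c * w j := (div_le_iff₀ hwj).mp (hmax j hj)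
      have h2 := Real.rpow_le_rpow_of_nonpos hwj' h1 hneg
      rw [Real.mul_rpow hc0.le hwj.le] at h2
      calc w j ^ (1 - 2 / p)
          = c ^ (2 / p - 1) * (c ^ (1 - 2 / p) * w j ^ (1 - 2 / p)) := by
            rw [← mul_assoc, ← Real.rpow_add hc0]; simp
        _ ≤ _ := mul_le_mul_of_nonneg_left h2 (Real.rpow_nonneg hc0.le _)
  have hlev := leverage_le_mul (hw.rpow_nonneg hp _) (hw'.rpow_nonneg hp _)
    (hw.row_eq_zero_or _ k) (hw'.row_eq_zero_or _ k) hA'k (Real.rpow_nonneg hc0.le _) hform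
  -- At the maximizing row the comparison reads c^(2/p) ≤ c^(2/p - 1), which fails for c > 1.
  rw [hw.leverage_eq hp, hw'.leverage_eq hp, show w' k = c * w k by rw [hc]; field_simp,
    Real.mul_rpow hc0.le hwk.le] at hlev
  have h3 := le_of_mul_le_mul_right hlev (Real.rpow_pos_of_pos hwk _)
  by_contra! hlt
  exact absurd ((Real.rpow_le_rpow_left_iff hlt).mp h3) (by linarith)

theorem IsLewisWeights.unique (hp : 0 < p) (hp2 : p < 2) (hw : IsLewisWeights p A w)
    (hw' : IsLewisWeights p A w') : w = w' := by
  funext i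
  by_cases hi : A i = 0
  · rw [hw.eq_zero hp hi, hw'.eq_zero hp hi]
  · exact le_antisymm (hw'.le_of_extends hp hp2 hw (fun _ => Or.inr rfl) hi)
      (hw.le_of_extends hp hp2 hw' (fun _ => Or.inr rfl) hi)

/-- One step of the Lewis weight iteration, on the logarithms of the weights. -/
noncomputable def logLewisIterate (p : ℝ) (A : Matrix (Fin n) (Fin d) ℝ) (u : Fin n → ℝ) :
    Fin n → ℝ :=
  open Classical in fun i =>
    if A i = 0 then 0 else p / 2 * Real.log (leverage A (fun j => Real.exp (u j * (1 - 2 / p))) i)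

/-- Moving the logarithms by at most δ changes the coefficients, hence the leverages, by a factor of
at most exp((2/p - 1)δ); the outer p/2 turns this into 1 - p/2 < 1. -/
theorem logLewisIterate_sub_le (hp : 0 < p) (hp2 : p < 2) (u v : Fin n → ℝ) (i : Fin n) :
    logLewisIterate p A u i - logLewisIterate p A v i ≤ (1 - p / 2) * dist u v := by
  by_cases hi : A i = 0
  · simp only [logLewisIterate, hi, if_true, sub_self]
    exact mul_nonneg (by linarith) dist_nonneg
  · simp only [logLewisIterate, hi, if_false]
    have hpos : ∀ u : Fin n → ℝ,
        0 < leverage A (fun j => Real.exp (u j * (1 - 2 / p))) i := fun u =>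
      leverage_pos (fun j => (Real.exp_pos _).le) (Real.exp_pos _).ne' hi
    have hle : leverage A (fun j => Real.exp (u j * (1 - 2 / p))) i ≤
        Real.exp ((2 / p - 1) * dist u v) *
          leverage A (fun j => Real.exp (v j * (1 - 2 / p))) i := by
      refine leverage_le_mul (fun j => (Real.exp_pos _).le) (fun j => (Real.exp_pos _).le)
        (Or.inr (Real.exp_pos _).ne') (Or.inr (Real.exp_pos _).ne') rfl (Real.exp_pos _).le
        fun x => ?_
      simp only [weightedForm, Finset.mul_sum]
      refine Finset.sum_le_sum fun j _ => ?_
      rw [← mul_assoc, ← Real.exp_add]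
      refine mul_le_mul_of_nonneg_right (Real.exp_le_exp.mpr ?_) (sq_nonneg _)
      have h1 : u j - v j ≤ dist u v :=
        (le_abs_self _).trans ((Real.dist_eq _ _).symm.le.trans (dist_le_pi_dist u v j))
      have h2 : 0 ≤ 2 / p - 1 := by
        rw [sub_nonneg, le_div_iff₀ hp]; linarith
      nlinarith [mul_le_mul_of_nonneg_left h1 h2]
    have hlog := Real.log_le_log (hpos u) hle
    rw [Real.log_mul (Real.exp_pos _).ne' (hpos v).ne', Real.log_exp] at hlog
    have h3 : p / 2 * ((2 / p - 1) * dist u v) = (1 - p / 2) * dist u v := by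
      field_simp
    have h4 := mul_le_mul_of_nonneg_left hlog (show 0 ≤ p / 2 by positivity)
    rw [mul_add, h3] at h4
    linarith

theorem contractingWith_logLewisIterate (hp : 0 < p) (hp2 : p < 2) :
    ContractingWith (Real.toNNReal (1 - p / 2)) (logLewisIterate p A) := by
  refine ⟨?_, LipschitzWith.of_dist_le_mul fun u v => ?_⟩
  · rw [Real.toNNReal_lt_one]; linarith
  · have h0 : 0 ≤ 1 - p / 2 := by linarith
    rw [Real.coe_toNNReal _ h0]
    refine (dist_pi_le_iff (mul_nonneg h0 dist_nonneg)).mpr fun i => ?_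
    rw [Real.dist_eq]
    refine abs_sub_le_iff.mpr ⟨logLewisIterate_sub_le hp hp2 u v i, ?_⟩
    rw [dist_comm u v]
    exact logLewisIterate_sub_le hp hp2 v u i

theorem exists_isLewisWeights (hp : 0 < p) (hp2 : p < 2) (A : Matrix (Fin n) (Fin d) ℝ) :
    ∃ w, IsLewisWeights p A w := by
  classical
  have hcon := contractingWith_logLewisIterate (A := A) hp hp2
  obtain ⟨u, hu⟩ : ∃ u, logLewisIterate p A u = u := ⟨_, hcon.fixedPoint_isFixedPt⟩
  -- Zero rows had a dummy logarithm 0 in the iteration; their true weight is 0, and the form does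
  -- not see the difference.
  set w : Fin n → ℝ := fun i => if A i = 0 then 0 else Real.exp (u i) with hw
  have hw0 : ∀ i, 0 ≤ w i := fun i => by
    simp only [hw]; split_ifs <;> positivity
  have hwpos : ∀ i, A i ≠ 0 → 0 < w i := fun i hi => by
    simp only [hw, if_neg hi]; positivity
  have hexp : ∀ i, A i ≠ 0 → w i ^ (1 - 2 / p) = Real.exp (u i * (1 - 2 / p)) := fun i hi => by
    simp only [hw, if_neg hi, Real.exp_mul]
  have hform : ∀ x, weightedForm A (fun j => w j ^ (1 - 2 / p)) x =
      weightedForm A (fun j => Real.exp (u j * (1 - 2 / p))) x := fun x => by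
    refine Finset.sum_congr rfl fun j _ => ?_
    by_cases hj : A j = 0
    · simp [hj]
    · simp only [hexp j hj]
  refine ⟨w, hwpos, fun i => ?_⟩
  change w i = leverage A (fun j => w j ^ (1 - 2 / p)) i ^ (p / 2)
  by_cases hi : A i = 0
  · simp only [leverage, hi, zero_dotProduct, Real.zero_rpow (show p / 2 ≠ 0 by positivity)]
    simp [hw, hi]
  · have hs : ∀ j, 0 ≤ w j ^ (1 - 2 / p) := fun j => Real.rpow_nonneg (hw0 j) _
    have hsi : A i = 0 ∨ w i ^ (1 - 2 / p) ≠ 0 :=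
      Or.inr (Real.rpow_pos_of_pos (hwpos i hi) _).ne'
    have hlev : leverage A (fun j => w j ^ (1 - 2 / p)) i =
        leverage A (fun j => Real.exp (u j * (1 - 2 / p))) i := by
      apply le_antisymm
      · simpa using leverage_le_mul (c := 1) (fun j => (Real.exp_pos _).le) hs
          (Or.inr (Real.exp_pos _).ne') hsi rfl zero_le_one fun x => by rw [one_mul, hform]
      · simpa using leverage_le_mul (c := 1) hs (fun j => (Real.exp_pos _).le) hsi
          (Or.inr (Real.exp_pos _).ne') rfl zero_le_one fun x => by rw [one_mul, hform]
    have hpos : 0 < leverage A (fun j => Real.exp (u j * (1 - 2 / p))) i :=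
      leverage_pos (fun j => (Real.exp_pos _).le) (Real.exp_pos _).ne' hi
    have hui := congrFun hu i
    simp only [logLewisIterate, if_neg hi] at hui
    rw [hlev, Real.rpow_def_of_pos hpos, mul_comm, hui]
    simp only [hw, if_neg hi]

theorem existsUnique_isLewisWeights (hp : 0 < p) (hp2 : p < 2) (A : Matrix (Fin n) (Fin d) ℝ) :
    ∃! w, IsLewisWeights p A w := by
  obtain ⟨w, hw⟩ := exists_isLewisWeights hp hp2 A
  exact ⟨w, hw, fun w' hw' => hw'.unique hp hp2 hw⟩

theorem lewisWeights_spec (hp : 0 < p) (hp2 : p < 2) (A : Matrix (Fin n) (Fin d) ℝ) :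
    IsLewisWeights p A (lewisWeights p A) := by
  have h := exists_isLewisWeights hp hp2 A
  rw [lewisWeights, dif_pos h]
  exact Classical.choose_spec h

end LewisWeights

/-! ### Determinants of regularized Gram matrices. -/

section Determinant

variable {n d : ℕ}

theorem Matrix.PosDef.sq_dotProduct_le {N : Matrix (Fin d) (Fin d) ℝ} (hN : N.PosDef)
    (a y : Fin d → ℝ) : (a ⬝ᵥ y) ^ 2 ≤ (a ⬝ᵥ (N⁻¹ *ᵥ a)) * (y ⬝ᵥ (N *ᵥ y)) := by
  have hdet : IsUnit N.det := hN.det_pos.ne'.isUnit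
  have hT : Nᵀ = N := by simpa using hN.isHermitian.eq
  by_cases hy : y = 0
  · simp [hy]
  have ht : 0 < y ⬝ᵥ (N *ᵥ y) := by simpa using hN.dotProduct_mulVec_pos hy
  set z := N⁻¹ *ᵥ a with hz
  set t := y ⬝ᵥ (N *ᵥ y) with htdef
  have hNz : N *ᵥ z = a := by
    rw [hz, Matrix.mulVec_mulVec, Matrix.mul_nonsing_inv _ hdet, Matrix.one_mulVec]
  have hzy : z ⬝ᵥ (N *ᵥ y) = a ⬝ᵥ y := by
    rw [Matrix.dotProduct_mulVec, ← Matrix.mulVec_transpose, hT, hNz]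
  -- Cauchy–Schwarz for the inner product of `N`: this form equals `t` times the desired difference.
  have h := hN.posSemidef.dotProduct_mulVec_nonneg (t • z - (a ⬝ᵥ y) • y)
  simp only [star_trivial, Matrix.mulVec_sub, Matrix.mulVec_smul, dotProduct_sub, sub_dotProduct,
    dotProduct_smul, smul_dotProduct, smul_eq_mul, hNz, hzy, ← htdef] at h
  rw [dotProduct_comm z a, dotProduct_comm y a] at h
  have h' : 0 ≤ t * (a ⬝ᵥ z * t - (a ⬝ᵥ y) ^ 2) := by linarith
  linarith [nonneg_of_mul_nonneg_right h' ht]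

theorem Matrix.det_add_smul_vecMulVec {N : Matrix (Fin d) (Fin d) ℝ} (hN : IsUnit N.det) (s : ℝ)
    (a : Fin d → ℝ) :
    (N + s • Matrix.vecMulVec a a).det = N.det * (1 + s * (a ⬝ᵥ (N⁻¹ *ᵥ a))) := by
  have h := Matrix.det_add_replicateCol_mul_replicateRow (ι := Unit) hN (s • a) a
  have h1 : Matrix.replicateCol Unit (s • a) * Matrix.replicateRow Unit a =
      s • Matrix.vecMulVec a a := by
    ext i j
    simp [Matrix.mul_apply, Matrix.vecMulVec_apply, mul_assoc]
  rw [h1] at h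
  rw [h, Matrix.det_unique (n := Unit), Matrix.add_apply, Matrix.one_apply_eq, Matrix.mul_assoc]
  congr 2
  rw [Matrix.mul_apply]
  have h2 : ∀ i, (N⁻¹ * Matrix.replicateCol Unit (s • a)) i default = s * (N⁻¹ *ᵥ a) i := by
    intro i
    simp only [Matrix.mul_apply, Matrix.replicateCol_apply, Pi.smul_apply, smul_eq_mul,
      Matrix.mulVec, dotProduct, Finset.mul_sum]
    exact Finset.sum_congr rfl fun j _ => by ring
  simp only [h2, Matrix.replicateRow_apply, dotProduct, Finset.mul_sum]
  exact Finset.sum_congr rfl fun j _ => by ring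

theorem Matrix.PosDef.det_le_pow {N : Matrix (Fin d) (Fin d) ℝ} (hN : N.PosDef) {K : ℝ}
    (h : ∀ x, x ⬝ᵥ (N *ᵥ x) ≤ K * (x ⬝ᵥ x)) : N.det ≤ K ^ d := by
  rw [hN.isHermitian.det_eq_prod_eigenvalues]
  calc ∏ i, ((hN.isHermitian.eigenvalues i : ℝ)) ≤ ∏ _i : Fin d, K := by
        refine Finset.prod_le_prod (fun i _ => (hN.eigenvalues_pos i).le) fun i _ => ?_
        rw [hN.isHermitian.eigenvalues_eq]
        have h1 := h (hN.isHermitian.eigenvectorBasis i)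
        have h2 := hN.isHermitian.eigenvectorBasis.orthonormal.1 i
        have h3 : (⇑(hN.isHermitian.eigenvectorBasis i) : Fin d → ℝ) ⬝ᵥ
            ⇑(hN.isHermitian.eigenvectorBasis i) = 1 := by
          have h4 := EuclideanSpace.real_norm_sq_eq (hN.isHermitian.eigenvectorBasis i)
          rw [h2] at h4
          simp only [dotProduct, ← sq]
          linarith
        rw [h3, mul_one] at h1
        simpa using h1
    _ = K ^ d := by simp

/-- The regularized Gram matrix `λ I + Aᵀ diag(c) A`. -/
noncomputable def ridgeGram (A : Matrix (Fin n) (Fin d) ℝ) (lam : ℝ) (c : Fin n → ℝ) :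
    Matrix (Fin d) (Fin d) ℝ :=
  lam • (1 : Matrix (Fin d) (Fin d) ℝ) + Aᵀ * Matrix.diagonal c * A

variable {A : Matrix (Fin n) (Fin d) ℝ} {lam : ℝ} {c : Fin n → ℝ}

theorem dotProduct_ridgeGram_mulVec (x : Fin d → ℝ) :
    x ⬝ᵥ (ridgeGram A lam c *ᵥ x) = lam * (x ⬝ᵥ x) + weightedForm A c x := by
  rw [ridgeGram, Matrix.add_mulVec, dotProduct_add, dotProduct_gram_mulVec_self,
    Matrix.smul_mulVec, Matrix.one_mulVec, dotProduct_smul, smul_eq_mul]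

theorem posDef_ridgeGram (hlam : 0 < lam) (hc : ∀ j, 0 ≤ c j) : (ridgeGram A lam c).PosDef := by
  refine Matrix.PosDef.of_dotProduct_mulVec_pos ?_ fun x hx => ?_
  · rw [Matrix.IsHermitian, Matrix.conjTranspose_eq_transpose_of_trivial, ridgeGram,
      Matrix.transpose_add, gram_transpose, Matrix.transpose_smul, Matrix.transpose_one]
  · rw [star_trivial, dotProduct_ridgeGram_mulVec]
    have h0 : 0 < x ⬝ᵥ x :=
      lt_of_le_of_ne (Finset.sum_nonneg fun i _ => mul_self_nonneg (x i))
        (Ne.symm fun h => hx (dotProduct_self_eq_zero.mp h))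
    have := weightedForm_nonneg (A := A) hc x
    positivity

theorem ridgeGram_add_single (i : Fin n) (s : ℝ) :
    ridgeGram A lam (c + Pi.single i s) =
      ridgeGram A lam c + s • Matrix.vecMulVec (A i) (A i) := by
  rw [ridgeGram, ridgeGram, add_assoc]
  congr 1
  ext k l
  have hent : ∀ c : Fin n → ℝ, (Aᵀ * Matrix.diagonal c * A) k l = ∑ j, c j * (A j k * A j l) := by
    intro c
    rw [Matrix.mul_apply]
    refine Finset.sum_congr rfl fun j _ => ?_
    rw [Matrix.mul_diagonal, Matrix.transpose_apply]
    ring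
  rw [Matrix.add_apply, hent, hent, Matrix.smul_apply, Matrix.vecMulVec_apply, smul_eq_mul]
  simp only [Pi.add_apply, add_mul, Finset.sum_add_distrib]
  congr 1
  rw [Finset.sum_eq_single i]
  · rw [Pi.single_eq_same]
  · intro j _ hj
    rw [Pi.single_eq_of_ne hj, zero_mul]
  · simp

theorem det_ridgeGram_add_single_ge (hlam : 0 < lam) (hc : ∀ j, 0 ≤ c j) (i : Fin n) {s : ℝ}
    {r : ℝ} (hr : r ≤ s * (A i ⬝ᵥ ((ridgeGram A lam c)⁻¹ *ᵥ A i))) :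
    (ridgeGram A lam c).det * (1 + r) ≤ (ridgeGram A lam (c + Pi.single i s)).det := by
  have hN := posDef_ridgeGram (A := A) hlam hc
  rw [ridgeGram_add_single, Matrix.det_add_smul_vecMulVec hN.det_pos.ne'.isUnit]
  exact mul_le_mul_of_nonneg_left (by linarith) hN.det_pos.le

/-- Raise the coefficients one at a time; each is a rank-one update with nonnegative gain. -/
theorem det_ridgeGram_mono (hlam : 0 < lam) (hc : ∀ j, 0 ≤ c j) {c' : Fin n → ℝ}
    (hcc' : ∀ j, c j ≤ c' j) : (ridgeGram A lam c).det ≤ (ridgeGram A lam c').det := by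
  have key : ∀ S : Finset (Fin n), (∀ j, 0 ≤ (c + ∑ i ∈ S, Pi.single i (c' i - c i)) j) ∧
      (ridgeGram A lam c).det ≤
        (ridgeGram A lam (c + ∑ i ∈ S, Pi.single i (c' i - c i))).det := by
    intro S
    induction S using Finset.induction_on with
    | empty => simpa using hc
    | insert a S ha ih =>
      rw [Finset.sum_insert ha, add_comm (Pi.single a _), ← add_assoc]
      refine ⟨fun j => add_nonneg (ih.1 j) ?_, ih.2.trans ?_⟩
      · by_cases hj : j = a
        · subst hj; simpa using hcc' j
        · simp [Pi.single_eq_of_ne hj]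
      · have h0 := (posDef_ridgeGram (A := A) hlam ih.1).inv.posSemidef.dotProduct_mulVec_nonneg
          (A a)
        rw [star_trivial] at h0
        have h := det_ridgeGram_add_single_ge hlam ih.1 a
          (mul_nonneg (sub_nonneg.mpr (hcc' a)) h0)
        rwa [add_zero, mul_one] at h
  have h := (key Finset.univ).2
  have h1 : c + ∑ i, Pi.single i (c' i - c i) = c' := by
    rw [Finset.univ_sum_single fun i => c' i - c i]
    funext j; simp
  rwa [h1] at h

end Determinant

/-! ### Bounds on the weights and growth of the determinant. -/

section LeadingRows

variable {p : ℝ} {n d : ℕ} {A : Matrix (Fin n) (Fin d) ℝ} {w : Fin n → ℝ}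

/-- At the vector attaining the leverage, the term of row i alone is at most the whole form. -/
theorem IsLewisWeights.le_one (hp : 0 < p) (hw : IsLewisWeights p A w) (i : Fin n) : w i ≤ 1 := by
  by_cases hi : A i = 0
  · rw [hw.eq_zero hp hi]; exact zero_le_one
  have hwi := hw.pos i hi
  obtain ⟨y, h1, h2⟩ := exists_dotProduct_eq_leverage (hw.rpow_nonneg hp _)
    (hw.row_eq_zero_or (1 - 2 / p) i)
  have h3 : w i ^ (1 - 2 / p) * (A i ⬝ᵥ y) ^ 2 ≤ _ :=
    Finset.single_le_sum (f := fun j => w j ^ (1 - 2 / p) * (A j ⬝ᵥ y) ^ 2)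
      (fun j _ => mul_nonneg (hw.rpow_nonneg hp _ j) (sq_nonneg _)) (Finset.mem_univ i)
  change _ ≤ weightedForm A _ y at h3
  rw [h1, h2, hw.leverage_eq hp, sq, ← mul_assoc, ← Real.rpow_add hwi, sub_add_cancel,
    Real.rpow_one] at h3
  exact le_of_mul_le_mul_right (by rwa [one_mul]) (Real.rpow_pos_of_pos hwi _)

/-- A small weight gives a large coefficient, but also forces (aⱼ·x)² ≤ wⱼ^(2/p) Q. Each term is
thus at most Q(b/Q)^(p/2), and summation gives 1 ≤ n(b/Q)^(p/2). Here p ≥ 1 matters: it yields the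
power n². -/
theorem IsLewisWeights.weightedForm_le (hp : 1 ≤ p) (hp2 : p < 2) (hw : IsLewisWeights p A w)
    (x : Fin d → ℝ) :
    weightedForm A (fun j => w j ^ (1 - 2 / p)) x ≤ (n : ℝ) ^ 2 * ∑ j, (A j ⬝ᵥ x) ^ 2 := by
  have hp0 : 0 < p := by linarith
  set Q := weightedForm A (fun j => w j ^ (1 - 2 / p)) x with hQ
  set b := ∑ j, (A j ⬝ᵥ x) ^ 2 with hb
  have hb0 : 0 ≤ b := Finset.sum_nonneg fun j _ => sq_nonneg _
  rcases (weightedForm_nonneg (A := A) (hw.rpow_nonneg hp0 (1 - 2 / p)) x).eq_or_lt with h0 | hQ0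
  · rw [hQ, ← h0]; positivity
  change 0 < Q at hQ0
  have hterm : ∀ j, w j ^ (1 - 2 / p) * (A j ⬝ᵥ x) ^ 2 ≤ Q * (b / Q) ^ (p / 2) := by
    intro j
    have hR : 0 ≤ Q * (b / Q) ^ (p / 2) :=
      mul_nonneg hQ0.le (Real.rpow_nonneg (div_nonneg hb0 hQ0.le) _)
    by_cases hj : A j ⬝ᵥ x = 0
    · rw [hj, zero_pow two_ne_zero, mul_zero]; exact hR
    have hAj : A j ≠ 0 := fun h => hj (by rw [h, zero_dotProduct])
    have hwj := hw.pos j hAj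
    have hlev := sq_dotProduct_le_leverage_mul (hw.rpow_nonneg hp0 _)
      (hw.row_eq_zero_or (1 - 2 / p) j) x
    rw [hw.leverage_eq hp0, ← hQ, ← div_le_iff₀ hQ0] at hlev
    have hbj : (A j ⬝ᵥ x) ^ 2 ≤ b :=
      Finset.single_le_sum (f := fun j => (A j ⬝ᵥ x) ^ 2) (fun j _ => sq_nonneg _)
        (Finset.mem_univ j)
    have hsq : 0 < (A j ⬝ᵥ x) ^ 2 := by positivity
    generalize (A j ⬝ᵥ x) ^ 2 = bj at hlev hbj hsq
    have hr : 0 < bj / Q := div_pos hsq hQ0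
    have hneg : p / 2 - 1 ≤ 0 := by linarith
    have h1 := Real.rpow_le_rpow_of_nonpos hr hlev hneg
    rw [← Real.rpow_mul hwj.le, show 2 / p * (p / 2 - 1) = 1 - 2 / p by field_simp] at h1
    calc w j ^ (1 - 2 / p) * bj ≤ (bj / Q) ^ (p / 2 - 1) * bj :=
          mul_le_mul_of_nonneg_right h1 hsq.le
      _ = Q * (bj / Q) ^ (p / 2) := by
          rw [Real.rpow_sub_one hr.ne']; field_simp
      _ ≤ Q * (b / Q) ^ (p / 2) := by gcongr
  have hsum : Q ≤ n * (Q * (b / Q) ^ (p / 2)) := by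
    calc Q ≤ ∑ _j : Fin n, Q * (b / Q) ^ (p / 2) := Finset.sum_le_sum fun j _ => hterm j
      _ = _ := by simp
  have h1 : 1 ≤ n * (b / Q) ^ (p / 2) := by
    rw [mul_left_comm] at hsum
    exact le_of_mul_le_mul_left (by rwa [mul_one]) hQ0
  have hn : (1 : ℝ) ≤ n := by
    rcases Nat.eq_zero_or_pos n with hn | hn
    · rw [hn] at h1; norm_num at h1
    · exact_mod_cast hn
  rcases le_total (b / Q) 1 with hle | hge
  · have h2 : (b / Q) ^ (p / 2) ≤ (b / Q) ^ (1 / 2 : ℝ) := by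
      rcases (div_nonneg hb0 hQ0.le).eq_or_lt with h | h
      · rw [← h, Real.zero_rpow (by positivity), Real.zero_rpow (by norm_num)]
      · exact Real.rpow_le_rpow_of_exponent_ge h hle (by linarith)
    rw [← Real.sqrt_eq_rpow] at h2
    have h3 : 1 ≤ n * √(b / Q) := h1.trans (mul_le_mul_of_nonneg_left h2 (by positivity))
    have h4 := one_le_pow₀ h3 (n := 2)
    rw [mul_pow, Real.sq_sqrt (div_nonneg hb0 hQ0.le), ← mul_div_assoc, le_div_iff₀ hQ0,
      one_mul] at h4
    exact h4
  · rw [le_div_iff₀ hQ0, one_mul] at hge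
    exact hge.trans (le_mul_of_one_le_left hb0 (one_le_pow₀ hn))

/-- The matrix `A` with all rows but the first `t` replaced by zero. -/
def leadingRows (A : Matrix (Fin n) (Fin d) ℝ) (t : ℕ) : Matrix (Fin n) (Fin d) ℝ :=
  fun j => if (j : ℕ) < t then A j else 0

theorem leadingRows_of_lt {t : ℕ} {j : Fin n} (h : (j : ℕ) < t) : leadingRows A t j = A j :=
  if_pos h

theorem leadingRows_of_le {t : ℕ} {j : Fin n} (h : t ≤ j) : leadingRows A t j = 0 :=
  if_neg h.not_gt

theorem leadingRows_self (A : Matrix (Fin n) (Fin d) ℝ) : leadingRows A n = A :=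
  funext fun j => leadingRows_of_lt j.isLt

/-- Zero rows do not change the Gram matrix. Padding with them puts all stages on one index type,
where coefficients compare entrywise. -/
theorem IsLewisWeights.of_leadingRows {i : Fin n} (hw : IsLewisWeights p (leadingRows A (i + 1)) w) :
    IsLewisWeights p (rowsUpTo A i) (w ∘ Fin.castLE i.isLt) := by
  have hrow : ∀ j, rowsUpTo A i j = leadingRows A (i + 1) (Fin.castLE i.isLt j) := fun j =>
    (leadingRows_of_lt (by simpa using j.isLt)).symm
  have hgram : (rowsUpTo A i)ᵀ *
      Matrix.diagonal (fun j => (w ∘ Fin.castLE i.isLt) j ^ (1 - 2 / p)) * rowsUpTo A i =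
      (leadingRows A (i + 1))ᵀ * Matrix.diagonal (fun j => w j ^ (1 - 2 / p)) *
        leadingRows A (i + 1) := by
    ext k l
    rw [Matrix.mul_apply, Matrix.mul_apply]
    simp only [Matrix.mul_diagonal, Matrix.transpose_apply]
    refine Finset.sum_of_injOn (Fin.castLE i.isLt) (Fin.castLE_injective _).injOn
      (fun _ _ => Finset.mem_coe.mpr (Finset.mem_univ _)) (fun j _ hj => ?_) fun j _ => ?_
    · have hle : (i : ℕ) + 1 ≤ j := by
        by_contra! hlt
        exact hj ⟨⟨j, hlt⟩, by simp, rfl⟩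
      simp [leadingRows_of_le hle]
    · rw [hrow]; rfl
  refine ⟨fun j hj => hw.pos _ (hrow j ▸ hj), fun j => ?_⟩
  rw [hgram, hrow]
  exact hw.eq _

theorem onlineLewisWeight_eq (hp : 0 < p) (hp2 : p < 2) (i : Fin n) :
    onlineLewisWeight p A i = lewisWeights p (leadingRows A (i + 1)) i := by
  have h := (lewisWeights_spec hp hp2 (rowsUpTo A i)).unique hp hp2
    (lewisWeights_spec hp hp2 (leadingRows A (i + 1))).of_leadingRows
  rw [onlineLewisWeight, h]
  rfl

/-- The coefficients `wⱼ ^ (1 - 2/p)` for the Lewis weights `w` of the first `t` rows. -/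
noncomputable def onlineCoeff (p : ℝ) (A : Matrix (Fin n) (Fin d) ℝ) (t : ℕ) : Fin n → ℝ :=
  fun j => lewisWeights p (leadingRows A t) j ^ (1 - 2 / p)

theorem onlineCoeff_nonneg (hp : 0 < p) (hp2 : p < 2) (t : ℕ) (j : Fin n) :
    0 ≤ onlineCoeff p A t j :=
  (lewisWeights_spec hp hp2 _).rpow_nonneg hp _ j

/-- Uses the convention that 0 to a nonzero real power is 0, even a negative one. -/
theorem onlineCoeff_eq_zero (hp : 0 < p) (hp2 : p < 2) {t : ℕ} {j : Fin n}
    (h : leadingRows A t j = 0) : onlineCoeff p A t j = 0 := by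
  rw [onlineCoeff, (lewisWeights_spec hp hp2 _).eq_zero hp h, Real.zero_rpow]
  have : 1 < 2 / p := by rwa [lt_div_iff₀ hp, one_mul]
  linarith

theorem onlineCoeff_le_succ (hp : 0 < p) (hp2 : p < 2) (t : ℕ) (j : Fin n) :
    onlineCoeff p A t j ≤ onlineCoeff p A (t + 1) j := by
  by_cases hj : leadingRows A t j = 0
  · rw [onlineCoeff_eq_zero hp hp2 hj]
    exact onlineCoeff_nonneg hp hp2 _ _
  have hext : ∀ k, leadingRows A t k = 0 ∨ leadingRows A (t + 1) k = leadingRows A t k := by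
    intro k
    rcases lt_or_ge (k : ℕ) t with h | h
    · exact Or.inr (by rw [leadingRows_of_lt h, leadingRows_of_lt (h.trans t.lt_succ_self)])
    · exact Or.inl (leadingRows_of_le h)
  have hle := (lewisWeights_spec hp hp2 (leadingRows A t)).le_of_extends hp hp2
    (lewisWeights_spec hp hp2 (leadingRows A (t + 1))) hext hj
  refine Real.rpow_le_rpow_of_nonpos ?_ hle ?_
  · exact (lewisWeights_spec hp hp2 _).pos j (((hext j).resolve_left hj).symm ▸ hj)
  · rw [sub_nonpos, le_div_iff₀ hp]; linarith

theorem weightedForm_leadingRows_onlineCoeff (hp : 0 < p) (hp2 : p < 2) (t : ℕ) (x : Fin d → ℝ) :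
    weightedForm (leadingRows A t) (onlineCoeff p A t) x =
      weightedForm A (onlineCoeff p A t) x := by
  refine Finset.sum_congr rfl fun j _ => ?_
  rcases lt_or_ge (j : ℕ) t with h | h
  · rw [leadingRows_of_lt h]
  · rw [onlineCoeff_eq_zero hp hp2 (leadingRows_of_le h), zero_mul, zero_mul]

/-- The determinant of the regularized Gram matrix grows by a factor controlled by the online
Lewis weight, if `lam` bounds the squared singular values of the leading rows from below. -/
theorem det_ridgeGram_onlineCoeff_succ (hp : 0 < p) (hp2 : p < 2) {lam : ℝ} (hlam : 0 < lam)
    (i : Fin n)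
    (H : ∀ x, ∃ y, (∀ j, leadingRows A (i + 1) j ⬝ᵥ y = leadingRows A (i + 1) j ⬝ᵥ x) ∧
      lam * (y ⬝ᵥ y) ≤ ∑ j, (leadingRows A (i + 1) j ⬝ᵥ x) ^ 2) :
    (ridgeGram A lam (onlineCoeff p A i)).det * (1 + onlineLewisWeight p A i / 2) ≤
      (ridgeGram A lam (onlineCoeff p A (i + 1))).det := by
  have hlew := lewisWeights_spec hp hp2 (leadingRows A (i + 1))
  rw [onlineLewisWeight_eq hp hp2]
  have hc0 := onlineCoeff_nonneg (A := A) hp hp2 (i + 1)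
  have hform := weightedForm_leadingRows_onlineCoeff (A := A) hp hp2 (i + 1)
  set c := onlineCoeff p A (i + 1) with hc
  -- The new coefficients without row i: they dominate those of the previous stage, and restoring
  -- row i is a rank-one update.
  set c' := Function.update c i 0 with hc'
  have hc'0 : ∀ j, 0 ≤ c' j := fun j => by
    rw [hc', Function.update_apply]; split_ifs; exacts [le_rfl, hc0 j]
  have hc'c : ∀ j, c' j ≤ c j := fun j => by
    rw [hc', Function.update_apply]; split_ifs; exacts [hc0 j, le_rfl]
  have hsplit : c' + Pi.single i (c i) = c := by
    funext j
    by_cases hj : j = i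
    · subst hj; simp [hc']
    · simp [hc', hj]
  have hrow : leadingRows A (i + 1) i = A i := leadingRows_of_lt (Nat.lt_succ_self _)
  have hgain : lewisWeights p (leadingRows A (i + 1)) i / 2 ≤
      c i * (A i ⬝ᵥ ((ridgeGram A lam c')⁻¹ *ᵥ A i)) := by
    by_cases hi : A i = 0
    · rw [hlew.eq_zero hp (hrow.trans hi), hi, zero_dotProduct, mul_zero, zero_div]
    obtain ⟨x, hx1, hx2⟩ := exists_dotProduct_eq_leverage (hlew.rpow_nonneg hp _)
      (hlew.row_eq_zero_or (1 - 2 / p) i)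
    rw [hlew.leverage_eq hp] at hx1 hx2
    have hwi := hlew.pos i (hrow.symm ▸ hi)
    obtain ⟨y, hy1, hy2⟩ := H x
    have hKpos := Real.rpow_pos_of_pos hwi (2 / p)
    have hcK : c i * lewisWeights p (leadingRows A (i + 1)) i ^ (2 / p) =
        lewisWeights p (leadingRows A (i + 1)) i := by
      rw [hc, onlineCoeff, ← Real.rpow_add hwi, sub_add_cancel, Real.rpow_one]
    set K := lewisWeights p (leadingRows A (i + 1)) i ^ (2 / p)
    have hyK : A i ⬝ᵥ y = K := by rw [← hrow, hy1, hx1]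
    have hyform : weightedForm A c y = K := by
      rw [← hform, ← hx2]
      exact Finset.sum_congr rfl fun j _ => by rw [hy1]; rfl
    -- Weights are at most 1, so coefficients of nonzero rows are at least 1 and the unweighted sum
    -- is at most `K`.
    have hylam : lam * (y ⬝ᵥ y) ≤ K := by
      refine hy2.trans ?_
      rw [← hx2]
      refine Finset.sum_le_sum fun j _ => ?_
      by_cases hj : leadingRows A (i + 1) j = 0
      · simp [hj]
      · refine le_mul_of_one_le_left (sq_nonneg _) ?_
        refine Real.one_le_rpow_of_pos_of_le_one_of_nonpos (hlew.pos j hj) (hlew.le_one hp j) ?_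
        rw [sub_nonpos, le_div_iff₀ hp]; linarith
    have hN := (posDef_ridgeGram (A := A) hlam hc'0).sq_dotProduct_le (A i) y
    have hq := (posDef_ridgeGram (A := A) hlam hc'0).inv.posSemidef.dotProduct_mulVec_nonneg (A i)
    rw [star_trivial] at hq
    rw [dotProduct_ridgeGram_mulVec, hyK] at hN
    have hc'form : weightedForm A c' y ≤ K :=
      hyform ▸ Finset.sum_le_sum fun j _ => mul_le_mul_of_nonneg_right (hc'c j) (sq_nonneg _)
    generalize A i ⬝ᵥ ((ridgeGram A lam c')⁻¹ *ᵥ A i) = q at hN hq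
    -- Ridge term and form are each at most `K`: regularization costs a factor 2.
    have h1 : K * K ≤ 2 * q * K := by
      nlinarith [mul_le_mul_of_nonneg_left (add_le_add hylam hc'form) hq]
    have h2 := le_of_mul_le_mul_right h1 hKpos
    have h3 := mul_le_mul_of_nonneg_left h2 (hc0 i)
    rw [hcK] at h3
    linarith
  have hstep := det_ridgeGram_add_single_ge hlam hc'0 i hgain
  rw [hsplit] at hstep
  refine le_trans (mul_le_mul_of_nonneg_right ?_ ?_) hstep
  · refine det_ridgeGram_mono hlam (onlineCoeff_nonneg hp hp2 _) fun j => ?_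
    by_cases hj : j = i
    · subst hj
      rw [onlineCoeff_eq_zero hp hp2 (leadingRows_of_le le_rfl)]
      exact hc'0 j
    · rw [hc', Function.update_of_ne hj]
      exact onlineCoeff_le_succ hp hp2 _ j
  · have := hlew.nonneg hp i
    positivity

theorem div_three_le_log_one_add_half {x : ℝ} (h0 : 0 ≤ x) (h1 : x ≤ 1) :
    x / 3 ≤ Real.log (1 + x / 2) := by
  have h := Real.one_sub_inv_le_log_of_pos (show 0 < 1 + x / 2 by linarith)
  refine le_trans ?_ h
  rw [le_sub_iff_add_le, ← le_sub_iff_add_le', inv_le_comm₀ (by linarith) (by linarith)]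
  rw [inv_le_iff_one_le_mul₀ (by linarith)]
  nlinarith

/-- The increments of log det telescope from λ^d, where no row counts yet, to at most (λ + n²L)^d.
-/
theorem sum_onlineLewisWeight_le (hp : 1 ≤ p) (hp2 : p < 2) {lam : ℝ} (hlam : 0 < lam)
    (H : ∀ (i : Fin n) (x : Fin d → ℝ), ∃ y,
      (∀ j, leadingRows A (i + 1) j ⬝ᵥ y = leadingRows A (i + 1) j ⬝ᵥ x) ∧
      lam * (y ⬝ᵥ y) ≤ ∑ j, (leadingRows A (i + 1) j ⬝ᵥ x) ^ 2)
    {L : ℝ} (hL : ∀ x : Fin d → ℝ, ∑ j, (A j ⬝ᵥ x) ^ 2 ≤ L * (x ⬝ᵥ x)) (hL0 : 0 ≤ L) :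
    ∑ i, onlineLewisWeight p A i ≤ 3 * (d * Real.log (1 + (n : ℝ) ^ 2 * (L / lam))) := by
  have hp0 : 0 < p := by linarith
  set Φ : ℕ → ℝ := fun t => Real.log (ridgeGram A lam (onlineCoeff p A t)).det with hΦ
  have hpd := fun t => posDef_ridgeGram (A := A) hlam (onlineCoeff_nonneg (A := A) hp0 hp2 t)
  have hstep : ∀ i : Fin n, onlineLewisWeight p A i ≤ 3 * (Φ (i + 1) - Φ i) := by
    intro i
    have hw := lewisWeights_spec hp0 hp2 (leadingRows A (i + 1))
    have h0 : 0 ≤ onlineLewisWeight p A i := by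
      rw [onlineLewisWeight_eq hp0 hp2]; exact hw.nonneg hp0 i
    have h1 : onlineLewisWeight p A i ≤ 1 := by
      rw [onlineLewisWeight_eq hp0 hp2]; exact hw.le_one hp0 i
    have h2 : 0 < 1 + onlineLewisWeight p A i / 2 := by linarith
    have h3 := Real.log_le_log (mul_pos (hpd i).det_pos h2)
      (det_ridgeGram_onlineCoeff_succ hp0 hp2 hlam i (H i))
    rw [Real.log_mul (hpd i).det_pos.ne' h2.ne'] at h3
    have h4 := div_three_le_log_one_add_half h0 h1
    simp only [hΦ]
    linarith
  have hzero : onlineCoeff p A 0 = 0 :=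
    funext fun j => onlineCoeff_eq_zero hp0 hp2 (leadingRows_of_le (Nat.zero_le _))
  have hΦ0 : Φ 0 = d * Real.log lam := by
    simp only [hΦ, hzero, ridgeGram]
    simp
  have hΦn : Φ n ≤ d * Real.log (lam + (n : ℝ) ^ 2 * L) := by
    rw [← Real.log_pow]
    refine Real.log_le_log (hpd n).det_pos ((hpd n).det_le_pow fun x => ?_)
    rw [dotProduct_ridgeGram_mulVec, add_mul, mul_assoc]
    have h1 := (lewisWeights_spec hp0 hp2 (leadingRows A n)).weightedForm_le hp hp2 x
    change weightedForm _ (onlineCoeff p A n) x ≤ _ at h1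
    rw [leadingRows_self] at h1
    have h2 := mul_le_mul_of_nonneg_left (hL x) (sq_nonneg (n : ℝ))
    linarith
  calc ∑ i, onlineLewisWeight p A i ≤ ∑ i : Fin n, 3 * (Φ (i + 1) - Φ i) :=
        Finset.sum_le_sum fun i _ => hstep i
    _ = 3 * (Φ n - Φ 0) := by
        rw [← Finset.mul_sum, Fin.sum_univ_eq_sum_range (fun t => Φ (t + 1) - Φ t) n,
          Finset.sum_range_sub]
    _ ≤ 3 * (d * Real.log (lam + (n : ℝ) ^ 2 * L) - d * Real.log lam) := by
        rw [hΦ0]; linarith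
    _ = _ := by
        rw [← mul_sub, ← Real.log_div (by positivity) hlam.ne']
        congr 3
        field_simp

end LeadingRows

/-! ### From singular values to the online condition number. -/

section OnlineCond

variable {p : ℝ} {n d : ℕ} {A : Matrix (Fin n) (Fin d) ℝ}

open scoped Matrix.Norms.L2Operator in
theorem Matrix.dotProduct_mulVec_self_le {m k : Type*} [Fintype m] [Fintype k] [DecidableEq k]
    (B : Matrix m k ℝ) (x : k → ℝ) :
    (B *ᵥ x) ⬝ᵥ (B *ᵥ x) ≤ ‖B‖ ^ 2 * (x ⬝ᵥ x) := by
  have h := B.l2_opNorm_mulVec (WithLp.toLp 2 x)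
  have h2 := pow_le_pow_left₀ (norm_nonneg _) h 2
  rw [mul_pow, EuclideanSpace.real_norm_sq_eq, EuclideanSpace.real_norm_sq_eq] at h2
  simpa [dotProduct, sq] using h2

open scoped Matrix.Norms.L2Operator in
-- The witness is B†Bx, the projection of x onto the row space, where `B` consists of the first i +
-- 1 rows.
theorem exists_sum_sq_le_of_pinv_norm_le {ρ : ℝ} (hρ : 0 < ρ)
    (h : ∀ S : Finset (Fin n), S.Nonempty →
      ‖pinv (A.submatrix (fun i : {i // i ∈ S} => i.val) id)‖ ≤ ρ)
    (i : Fin n) (x : Fin d → ℝ) :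
    ∃ y, (∀ j, leadingRows A (i + 1) j ⬝ᵥ y = leadingRows A (i + 1) j ⬝ᵥ x) ∧
      (ρ ^ 2)⁻¹ * (y ⬝ᵥ y) ≤ ∑ j, (leadingRows A (i + 1) j ⬝ᵥ x) ^ 2 := by
  set S : Finset (Fin n) := Finset.univ.filter fun j => (j : ℕ) < i + 1 with hS
  have hmem : ∀ j, j ∈ S ↔ (j : ℕ) < i + 1 := fun j => by simp [hS]
  have hnorm := h S ⟨i, (hmem i).mpr (Nat.lt_succ_self _)⟩
  set B := A.submatrix (fun i : {i // i ∈ S} => i.val) id with hB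
  refine ⟨pinv B *ᵥ (B *ᵥ x), fun j => ?_, ?_⟩
  · rcases lt_or_ge (j : ℕ) (i + 1) with hj | hj
    · rw [leadingRows_of_lt hj]
      have h1 : B *ᵥ (pinv B *ᵥ (B *ᵥ x)) = B *ᵥ x := by
        rw [Matrix.mulVec_mulVec, Matrix.mulVec_mulVec, (pinv_spec B).mul_mul_left]
      exact congrFun h1 ⟨j, (hmem j).mpr hj⟩
    · rw [leadingRows_of_le hj, zero_dotProduct, zero_dotProduct]
  · have h1 := Matrix.dotProduct_mulVec_self_le (pinv B) (B *ᵥ x)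
    have h2 : (B *ᵥ x) ⬝ᵥ (B *ᵥ x) = ∑ j, (leadingRows A (i + 1) j ⬝ᵥ x) ^ 2 := by
      have h3 : ∀ j, (leadingRows A (i + 1) j ⬝ᵥ x) ^ 2 = if j ∈ S then (A j ⬝ᵥ x) ^ 2 else 0 := by
        intro j
        by_cases hj : (j : ℕ) < i + 1
        · rw [leadingRows_of_lt hj, if_pos ((hmem j).mpr hj)]
        · rw [leadingRows_of_le (not_lt.mp hj), if_neg (mt (hmem j).mp hj), zero_dotProduct,
            zero_pow two_ne_zero]
      rw [Finset.sum_congr rfl fun j _ => h3 j, Finset.sum_ite_mem, Finset.univ_inter,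
        ← Finset.sum_coe_sort]
      exact Finset.sum_congr rfl fun j _ => (sq _).symm
    rw [h2] at h1
    rw [inv_mul_le_iff₀ (by positivity)]
    refine h1.trans (mul_le_mul_of_nonneg_right ?_ (Finset.sum_nonneg fun j _ => sq_nonneg _))
    exact pow_le_pow_left₀ (norm_nonneg _) hnorm 2

open scoped Matrix.Norms.L2Operator in
theorem sum_onlineLewisWeight_le_log_onlineCond (hp : 1 ≤ p) (hp2 : p < 2) (hA : A ≠ 0) :
    ∑ i, onlineLewisWeight p A i ≤
      3 * (d * Real.log (1 + (n : ℝ) ^ 2 * onlineCond A ^ 2)) := by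
  set f : {S : Finset (Fin n) // S.Nonempty} → ℝ := fun S =>
    ‖pinv (A.submatrix (fun i : {i // i ∈ S.val} => i.val) id)‖ with hf
  set ρ : ℝ := ⨆ S, f S with hρdef
  have hle : ∀ S, f S ≤ ρ := fun S => le_ciSup (Set.finite_range f).bddAbove S
  have hρ : 0 < ρ := by
    obtain ⟨i, hi⟩ : ∃ i, A i ≠ 0 := by
      by_contra! h
      exact hA (funext h)
    refine lt_of_lt_of_le ?_ (hle ⟨{i}, Finset.singleton_nonempty i⟩)
    refine norm_pos_iff.mpr fun h0 => hi ?_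
    have h1 := (pinv_spec (A.submatrix
      (fun j : {j // j ∈ ({i} : Finset (Fin n))} => j.val) id)).mul_mul_left
    rw [h0, Matrix.mul_zero, Matrix.zero_mul] at h1
    exact (congrFun h1 ⟨i, Finset.mem_singleton_self i⟩).symm
  have hmain := sum_onlineLewisWeight_le (A := A) hp hp2 (lam := (ρ ^ 2)⁻¹) (by positivity)
    (exists_sum_sq_le_of_pinv_norm_le hρ fun S hS => hle ⟨S, hS⟩) (L := ‖A‖ ^ 2)
    (fun x => by
      have h := Matrix.dotProduct_mulVec_self_le A x
      refine le_trans (le_of_eq (Finset.sum_congr rfl fun j _ => ?_)) h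
      exact sq _) (sq_nonneg _)
  have hκ : ‖A‖ ^ 2 / (ρ ^ 2)⁻¹ = onlineCond A ^ 2 := by
    rw [div_inv_eq_mul, ← mul_pow]
    rfl
  rwa [hκ] at hmain

/-- With a, b ≥ 1 the two maxima, the logarithm is at most 1 + 2a + 2b ≤ 5ab. -/
theorem log_one_add_sq_mul_sq_le (n : ℕ) {κ : ℝ} (hκ : 0 ≤ κ) :
    Real.log (1 + (n : ℝ) ^ 2 * κ ^ 2) ≤
      5 * (max 1 (Real.log n) * max 1 (Real.log κ)) := by
  set a := max 1 (Real.log n)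
  set b := max 1 (Real.log κ)
  have ha : 1 ≤ a := le_max_left _ _
  have hb : 1 ≤ b := le_max_left _ _
  have hn : (n : ℝ) ≤ Real.exp a := by
    rcases Nat.eq_zero_or_pos n with h | h
    · rw [h, Nat.cast_zero]; exact (Real.exp_pos _).le
    · have h' : (0 : ℝ) < n := by exact_mod_cast h
      rw [← Real.log_le_iff_le_exp h']; exact le_max_right _ _
  have hk : κ ≤ Real.exp b := by
    rcases hκ.eq_or_lt with h | h
    · rw [← h]; exact (Real.exp_pos _).le
    · rw [← Real.log_le_iff_le_exp h]; exact le_max_right _ _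
  have h1 : (n : ℝ) ^ 2 * κ ^ 2 ≤ Real.exp (2 * a + 2 * b) := by
    calc (n : ℝ) ^ 2 * κ ^ 2 ≤ Real.exp a ^ 2 * Real.exp b ^ 2 := by gcongr
      _ = Real.exp (2 * a + 2 * b) := by
        rw [← Real.exp_nat_mul, ← Real.exp_nat_mul, ← Real.exp_add]; norm_num
  have h2 : 1 + (n : ℝ) ^ 2 * κ ^ 2 ≤ Real.exp (1 + (2 * a + 2 * b)) := by
    rw [Real.exp_add]
    have h3 : 1 ≤ Real.exp (2 * a + 2 * b) := Real.one_le_exp (by linarith)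
    nlinarith [Real.add_one_le_exp (1 : ℝ)]
  have h3 : Real.log (1 + (n : ℝ) ^ 2 * κ ^ 2) ≤ 1 + (2 * a + 2 * b) := by
    rw [Real.log_le_iff_le_exp (by positivity)]; exact h2
  nlinarith [mul_nonneg (sub_nonneg.mpr ha) (sub_nonneg.mpr hb)]

open scoped Matrix.Norms.L2Operator in
theorem onlineCond_nonneg (A : Matrix (Fin n) (Fin d) ℝ) : 0 ≤ onlineCond A :=
  mul_nonneg (norm_nonneg _) (Real.iSup_nonneg fun _ => norm_nonneg _)

end OnlineCond

theorem mainTheorem9 :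
    ∃ C : ℝ, 0 < C ∧
      ∀ p : ℝ, 1 ≤ p → p < 2 →
        ∀ (n d : ℕ) (A : Matrix (Fin n) (Fin d) ℝ),
          (∀ i : Fin n, ∃! w, IsLewisWeights p (rowsUpTo A i) w) ∧
          ∑ i, onlineLewisWeight p A i ≤
            C * d * max 1 (Real.log n) * max 1 (Real.log (onlineCond A)) := by
  -- 15 = 3·5: the 3 from w/3 ≤ log(1 + w/2), the 5 from simplifying the logarithm.
  refine ⟨15, by norm_num, fun p hp hp2 n d A => ?_⟩
  have hp0 : 0 < p := by linarith
  refine ⟨fun i => existsUnique_isLewisWeights hp0 hp2 _, ?_⟩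
  -- For A = 0 the largest ‖A_S†‖ is 0, so λ would not be positive.
  by_cases hA : A = 0
  · have h0 : ∑ i, onlineLewisWeight p A i = 0 := Finset.sum_eq_zero fun i _ =>
      (lewisWeights_spec hp0 hp2 (rowsUpTo A i)).eq_zero hp0 (by rw [hA]; rfl)
    rw [h0]
    positivity
  · have h1 := mul_le_mul_of_nonneg_left (log_one_add_sq_mul_sq_le n (onlineCond_nonneg A))
      (show (0 : ℝ) ≤ d by positivity)
    have h2 := sum_onlineLewisWeight_le_log_onlineCond hp hp2 hA
    linarith
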